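/- All graphs are finite and simple. For a graph $G$ and $X\subseteq V(G)$, the cut-rank $\rho_G(X)$ is the rank over $\mathrm{GF}(2)$ of the $X\times(V(G)-X)$ submatrix of the adjacency matrix of $G$. For integers $k,\ell\ge 0$, $G$ is $k^{+\ell}$-rank-connected if $\min(|X|,|V(G)-X|)<k+\ell$ for every $X\subseteq V(G)$ with $\rho_G(X)<k$. $G$ is prime if it is connected and there is no $A\subseteq V(G)$ with $\rho_G(A)\le 1$ and $\min(|A|,|V(G)-A|)\ge 2$. For an edge $vw$ of $G$, pivoting $vw$ means the following: for any two vertices $x,y$ lying in two different sets among $N(v)-N(w)-\{w\}$, $N(w)-N(v)-\{v\}$, $N(v)\cap N(w)$, delete the edge $xy$ if it is present and add it if it is absent; then swap the labels of $v$ and $w$. A graph $H$ is a pivot-minor of $G$ if $H$ is an induced subgraph of a graph obtained from $G$ by a (possibly empty) sequence of pivots. **Theorem.** Every prime $3^{+2}$-rank-connected graph $G$ with at least $10$ vertices has a prime $3^{+3}$-rank-connected pivot-minor $H$ with $|V(H)|=|V(G)|-1$. -/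

import Mathlib

namespace RankConnectivity

section

variable {V : Type*}

/-- `ρ_G(X, Y)`: the rank over `GF(2)` of the `X × Y` submatrix of the adjacency matrix of `G`. -/
noncomputable def pairRank [Fintype V] (G : SimpleGraph V) (X Y : Finset V) : ℕ :=
  letI : DecidableRel G.Adj := Classical.decRel G.Adj
  ((G.adjMatrix (ZMod 2)).submatrix (fun x : X => (x : V)) (fun y : Y => (y : V))).rank

/-- The cut-rank function `ρ_G(X) = ρ_G(X, V(G) - X)`. -/
noncomputable def cutRank [Fintype V] [DecidableEq V] (G : SimpleGraph V) (X : Finset V) : ℕ :=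
  pairRank G X Xᶜ

/-- `G` is `k^{+ℓ}`-rank-connected. -/
def RankConnectedPlus [Fintype V] [DecidableEq V] (k l : ℕ) (G : SimpleGraph V) : Prop :=
  ∀ X : Finset V, cutRank G X < k → min X.card Xᶜ.card < k + l

/-- The partition `(A, V(G) - A)` is a split of `G`. -/
def IsSplit [Fintype V] [DecidableEq V] (G : SimpleGraph V) (A : Finset V) : Prop :=
  cutRank G A ≤ 1 ∧ 2 ≤ min A.card Aᶜ.card

/-- Prime with respect to split decompositions: connected and without splits. -/
def IsPrime [Fintype V] [DecidableEq V] (G : SimpleGraph V) : Prop :=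
  G.Connected ∧ ∀ A : Finset V, ¬ IsSplit G A

/-- The ordered pairs along which pivoting `vw` complements adjacency: a vertex of
`N(v) - N(w) - {w}` with one of `N(w) - N(v) - {v}`, a vertex of `N(v) - N(w) - {w}` with a
common neighbour, or a common neighbour with a vertex of `N(w) - N(v) - {v}`. -/
def PivotPair (G : SimpleGraph V) (v w x y : V) : Prop :=
  (x ∈ (G.neighborSet v \ G.neighborSet w) \ {w} ∧
      y ∈ (G.neighborSet w \ G.neighborSet v) \ {v}) ∨
  (x ∈ (G.neighborSet v \ G.neighborSet w) \ {w} ∧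
      y ∈ G.neighborSet w ∩ G.neighborSet v) ∨
  (x ∈ G.neighborSet v ∩ G.neighborSet w ∧
      y ∈ (G.neighborSet w \ G.neighborSet v) \ {v})

/-- The first step of pivoting `vw`: complement the adjacency of `x` and `y` for all pairs as in
`PivotPair`. -/
def pivotComplement (G : SimpleGraph V) (v w : V) : SimpleGraph V where
  Adj x y := Xor (G.Adj x y) (PivotPair G v w x y ∨ PivotPair G v w y x)
  symm := ⟨fun x y h => by
    rw [G.adj_comm y x, or_comm]
    exact h⟩
  loopless := ⟨fun x h => by
    simp only [Xor, PivotPair, Set.mem_sdiff, Set.mem_inter_iff, SimpleGraph.mem_neighborSet,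
      Set.mem_singleton_iff, SimpleGraph.irrefl] at h
    tauto⟩

/-- Pivoting the edge `vw` of `G`: after the complementation step, swap the labels of `v` and
`w`. -/
def pivot [DecidableEq V] (G : SimpleGraph V) (v w : V) : SimpleGraph V :=
  (pivotComplement G v w).comap (Equiv.swap v w)

/-- `G'` is obtained from `G` by pivoting one edge. -/
def PivotStep [DecidableEq V] (G G' : SimpleGraph V) : Prop :=
  ∃ v w : V, G.Adj v w ∧ G' = pivot G v w

/-- `G'` is obtained from `G` by a sequence of pivots. -/
def PivotEquivalent [DecidableEq V] (G G' : SimpleGraph V) : Prop :=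
  Relation.ReflTransGen PivotStep G G'

/-- The graph `H` with vertex set `S ⊆ V(G)` is a pivot-minor of `G`: it is an induced subgraph
of a graph pivot-equivalent to `G`. -/
def IsPivotMinor [DecidableEq V] {S : Finset V} (H : SimpleGraph S) (G : SimpleGraph V) : Prop :=
  ∃ G' : SimpleGraph V, PivotEquivalent G G' ∧ H = G'.comap (fun s : S => (s : V))

end

end RankConnectivity

/-!
Each vertex `v` is split into two halves, represented over `GF(2)` by the standard basis vector of
`v` and by the column of `v` in the adjacency matrix. If `r` is the rank function of this vector
configuration, then `f(A) = 2 r(A) - |A|` is submodular and is invariant under an orthogonality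
`perp`, and on sets consisting of both halves of all vertices in `X` it is twice the cut-rank of
`X`. Adding one half of a vertex `v ∉ X` gives twice the cut-rank of `X`, plus one, in `G` with `v`
deleted or in `G` pivoted on an edge `vw` and with `v` deleted, depending on the half
(`lam₁_graphHalfRank`, `lam₁_pivot`); pivoting is a linear isomorphism that exchanges the two
halves at both ends of the edge (`halfRk_pivot`). So the theorem becomes a statement on submodular
functions of half-vertices, `HalfRank.not_isCritical`: not every removal of a vertex through one
of its halves can be bad, where bad means that it creates a split or a separation of order at most
two with at least six vertices on both sides.

Suppose that all removals are bad, and write `λ` for the cut-rank. Uncrossing the two removals of a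
vertex shows that splits created by removals have sides of only two vertices, so that they come from
*triplets*, sets of three vertices with `λ = 2` (`exists_tied`). A set of four vertices with `λ = 2`
cannot exist (`not_quad`): the separations at its vertices could be moved off the set, so each of its
vertices would lie in a triplet inside the set to which it is tied, and this would create a split
with a side of three vertices. Hence two triplets never meet in exactly two vertices. If there were
no triplet, the four cells formed by the separations for the two removals of a vertex would be too
small (`exists_triplet`). Let finally `T = {v, p, q}` be a triplet. Each of its vertices has a
separation that separates the two other ones (`exists_crossing`). Write `X ∋ p` and `Y ∋ q` for the
sides at `v`, `A ∋ v` and `B ∋ q` for those at `p`, and `C ∋ v` and `D ∋ p` for those at `q`.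
Uncrossing pairs of them shows that cells such as `X ∩ B` and `Y ∩ A` have two or three vertices and
`λ = 2` (`card_inter_bounds`), uncrossing all three of them that also `λ(Y ∩ B) ≤ 2`
(`lam_inter_le_two`). So there are many triplets among the cells, and counting finds two of them
that meet in two vertices.
-/

/-! ### Half-ranks and uncrossing -/

namespace RankConnectivity

open Finset

/-- The orthogonal complement of a set of half-vertices: `(v, s)` belongs to it exactly when the
other half `(v, !s)` of `v` is not in the set. It exchanges "no half" and "both halves" and fixes
each single half. -/
def perp {V : Type*} [Fintype V] [DecidableEq V] (A : Finset (V × Bool)) : Finset (V × Bool) :=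
  univ.filter fun e => (e.1, !e.2) ∉ A

/-- A rank function on the doubled ground set `V × Bool`, in which each vertex `v` has the two
halves `(v, true)` and `(v, false)`, such that `2 r(A) - |A|` is invariant under `perp`. -/
structure HalfRank (V : Type*) [Fintype V] [DecidableEq V] where
  /-- The rank function. -/
  r : Finset (V × Bool) → ℤ
  submod : ∀ A B, r (A ∩ B) + r (A ∪ B) ≤ r A + r B
  le_insert : ∀ e A, r A ≤ r (insert e A)
  insert_le : ∀ e A, r (insert e A) ≤ r A + 1
  symm : ∀ A, 2 * r (perp A) - #(perp A) = 2 * r A - #A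

/-- Both halves of all vertices of `X`. -/
def dbl {V : Type*} (X : Finset V) : Finset (V × Bool) := X ×ˢ univ

@[simp] theorem mem_dbl {V : Type*} {X : Finset V} {e : V × Bool} : e ∈ dbl X ↔ e.1 ∈ X := by simp [dbl]

theorem card_dbl {V : Type*} (X : Finset V) : #(dbl X) = #X * 2 := by simp [dbl]

theorem dbl_insert {V : Type*} [DecidableEq V] (v : V) (s : Bool) (X : Finset V) :
    dbl (insert v X) = insert (v, !s) (insert (v, s) (dbl X)) := by
  ext ⟨x, t⟩
  by_cases hx : x = v
  · subst hx; cases s <;> cases t <;> simp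
  · simp [hx]

namespace HalfRank

variable {V : Type*} [Fintype V] [DecidableEq V] (c : HalfRank V)

/-- Twice the connectivity of a set of half-vertices. -/
def f (A : Finset (V × Bool)) : ℤ := 2 * c.r A - #A

/-- The connectivity of a set of vertices. -/
def lam (X : Finset V) : ℤ := c.r (dbl X) - #X

/-- The connectivity of `X` after the removal of the vertex `v` through its half `(v, s)`
(meaningful if `v ∉ X`). -/
def lam₁ (v : V) (s : Bool) (X : Finset V) : ℤ := c.r (insert (v, s) (dbl X)) - #X - 1

/-- The connectivity of `X` after the removal of the vertices `v` and `w` through the halves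
`(v, s)` and `(w, t)` (meaningful if `v ≠ w` and neither is in `X`). -/
def lam₂ (v : V) (s : Bool) (w : V) (t : Bool) (X : Finset V) : ℤ :=
  c.r (insert (v, s) (insert (w, t) (dbl X))) - #X - 2

variable {c}

theorem f_submod (A B : Finset (V × Bool)) : c.f (A ∩ B) + c.f (A ∪ B) ≤ c.f A + c.f B := by
  have h := c.submod A B
  have h' := card_inter_add_card_union A B
  unfold f
  zify at h'
  linarith

@[simp] theorem mem_perp {A : Finset (V × Bool)} {e : V × Bool} :
    e ∈ perp A ↔ (e.1, !e.2) ∉ A := by simp [perp]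

theorem f_perp (A : Finset (V × Bool)) : c.f (perp A) = c.f A := c.symm A

theorem f_dbl (X : Finset V) : c.f (dbl X) = 2 * c.lam X := by
  simp only [f, lam, card_dbl]; push_cast; ring

theorem f_half {v : V} (s : Bool) {X : Finset V} (hv : v ∉ X) :
    c.f (insert (v, s) (dbl X)) = 2 * c.lam₁ v s X + 1 := by
  rw [f, lam₁, card_insert_of_notMem (by simpa using hv), card_dbl]; push_cast; ring

theorem f_half₂ {v w : V} (s t : Bool) {X : Finset V} (hv : v ∉ X) (hw : w ∉ X) (h : v ≠ w) :
    c.f (insert (v, s) (insert (w, t) (dbl X))) = 2 * c.lam₂ v s w t X + 2 := by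
  rw [f, lam₂, card_insert_of_notMem (by simp [hv, h]), card_insert_of_notMem (by simpa using hw),
    card_dbl]
  push_cast; ring

theorem lam_compl (X : Finset V) : c.lam Xᶜ = c.lam X := by
  have : perp (dbl X) = dbl Xᶜ := by ext; simp
  have h := c.f_perp (dbl X)
  rw [this, f_dbl, f_dbl] at h
  linarith

theorem lam₁_compl {v : V} (s : Bool) {X : Finset V} (hv : v ∉ X) :
    c.lam₁ v s (insert v X)ᶜ = c.lam₁ v s X := by
  have : perp (insert (v, s) (dbl X)) = insert (v, s) (dbl (insert v X)ᶜ) := by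
    ext ⟨x, t⟩
    by_cases hx : x = v
    · subst hx; cases s <;> cases t <;> simp [hv]
    · simp [hx]
  have h := c.f_perp (insert (v, s) (dbl X))
  rw [this, f_half s hv, f_half s (by simp)] at h
  linarith

theorem lam₂_compl {v w : V} (s t : Bool) {X : Finset V} (hv : v ∉ X) (hw : w ∉ X) (h : v ≠ w) :
    c.lam₂ v s w t (insert v (insert w X))ᶜ = c.lam₂ v s w t X := by
  have : perp (insert (v, s) (insert (w, t) (dbl X))) =
      insert (v, s) (insert (w, t) (dbl (insert v (insert w X))ᶜ)) := by
    ext ⟨x, u⟩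
    by_cases hx : x = v
    · subst hx; cases s <;> cases u <;> simp [hv, h]
    · by_cases hx' : x = w
      · subst hx'; cases t <;> cases u <;> simp [hw, hx]
      · simp [hx, hx']
  have h' := c.f_perp (insert (v, s) (insert (w, t) (dbl X)))
  rw [this, f_half₂ s t hv hw h, f_half₂ s t (by simp) (by simp) h] at h'
  linarith

theorem lam_submod (X Y : Finset V) : c.lam (X ∩ Y) + c.lam (X ∪ Y) ≤ c.lam X + c.lam Y := by
  have h := c.f_submod (dbl X) (dbl Y)
  have h1 : dbl X ∩ dbl Y = dbl (X ∩ Y) := by ext; simp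
  have h2 : dbl X ∪ dbl Y = dbl (X ∪ Y) := by ext; simp
  rw [h1, h2] at h
  simp only [f_dbl] at h
  linarith

theorem lam_le_lam₁_add_one (v : V) (s : Bool) (X : Finset V) : c.lam X ≤ c.lam₁ v s X + 1 := by
  have := c.le_insert (v, s) (dbl X)
  unfold lam lam₁; linarith

theorem lam₁_le_lam (v : V) (s : Bool) (X : Finset V) : c.lam₁ v s X ≤ c.lam X := by
  have := c.insert_le (v, s) (dbl X)
  unfold lam lam₁; linarith

theorem lam_insert_le_lam₁_add_one {v : V} (s : Bool) {X : Finset V} (hv : v ∉ X) :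
    c.lam (insert v X) ≤ c.lam₁ v s X + 1 := by
  have := c.insert_le (v, !s) (insert (v, s) (dbl X))
  rw [← dbl_insert] at this
  unfold lam lam₁; rw [card_insert_of_notMem hv]; push_cast; linarith

theorem lam₁_insert_le_lam₂_add_one (v : V) (s : Bool) {w : V} (t : Bool) {X : Finset V}
    (hw : w ∉ X) : c.lam₁ v s (insert w X) ≤ c.lam₂ v s w t X + 1 := by
  have := c.insert_le (w, !t) (insert (v, s) (insert (w, t) (dbl X)))
  rw [insert_comm (w, !t), ← dbl_insert] at this
  unfold lam₁ lam₂; rw [card_insert_of_notMem hw]; push_cast; linarith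

theorem lam_insert_le {v : V} {X : Finset V} (hv : v ∉ X) : c.lam (insert v X) ≤ c.lam X + 1 := by
  have h1 := c.lam_insert_le_lam₁_add_one true hv
  have h2 := c.lam₁_le_lam v true X
  linarith

/-- Uncrossing of two removals of `v` through its two different halves. -/
theorem uncross_same {v : V} (s : Bool) {X Y : Finset V} (hX : v ∉ X) (hY : v ∉ Y) :
    c.lam (X ∩ Y) + c.lam (insert v (X ∪ Y)) ≤ c.lam₁ v s X + c.lam₁ v (!s) Y + 1 := by
  have h := c.f_submod (insert (v, s) (dbl X)) (insert (v, !s) (dbl Y))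
  have h1 : insert (v, s) (dbl X) ∩ insert (v, !s) (dbl Y) = dbl (X ∩ Y) := by
    ext ⟨x, t⟩
    by_cases hx : x = v
    · subst hx; cases s <;> cases t <;> simp [hX, hY]
    · simp [hx]
  have h2 : insert (v, s) (dbl X) ∪ insert (v, !s) (dbl Y) = dbl (insert v (X ∪ Y)) := by
    ext ⟨x, t⟩
    by_cases hx : x = v
    · subst hx; cases s <;> cases t <;> simp
    · simp [hx]
  rw [h1, h2, f_half _ hX, f_half _ hY] at h
  simp only [f_dbl] at h
  linarith

theorem uncross_mem {u : V} (s : Bool) {X Q : Finset V} (hX : u ∉ X) (hQ : u ∈ Q) :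
    c.lam₁ u s (X ∩ Q) + c.lam (X ∪ Q) ≤ c.lam₁ u s X + c.lam Q := by
  have h := c.f_submod (insert (u, s) (dbl X)) (dbl Q)
  have h1 : insert (u, s) (dbl X) ∩ dbl Q = insert (u, s) (dbl (X ∩ Q)) := by
    ext ⟨x, t⟩
    by_cases hx : x = u
    · subst hx; simp [hX, hQ]
    · simp [hx]
  have h2 : insert (u, s) (dbl X) ∪ dbl Q = dbl (X ∪ Q) := by
    ext ⟨x, t⟩
    by_cases hx : x = u
    · subst hx; simp [hQ]
    · simp [hx]
  rw [h1, h2, f_half _ hX, f_half _ (by simp [hX])] at h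
  simp only [f_dbl] at h
  linarith

theorem uncross_notMem {u : V} (s : Bool) {X Q : Finset V} (hX : u ∉ X) (hQ : u ∉ Q) :
    c.lam (X ∩ Q) + c.lam₁ u s (X ∪ Q) ≤ c.lam₁ u s X + c.lam Q := by
  have h := c.f_submod (insert (u, s) (dbl X)) (dbl Q)
  have h1 : insert (u, s) (dbl X) ∩ dbl Q = dbl (X ∩ Q) := by
    ext ⟨x, t⟩
    by_cases hx : x = u
    · subst hx; simp [hX, hQ]
    · simp [hx]
  have h2 : insert (u, s) (dbl X) ∪ dbl Q = insert (u, s) (dbl (X ∪ Q)) := by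
    ext ⟨x, t⟩
    by_cases hx : x = u
    · subst hx; simp [hQ]
    · simp [hx]
  rw [h1, h2, f_half _ hX, f_half _ (by simp [hX, hQ])] at h
  simp only [f_dbl] at h
  linarith

/-- Uncrossing of removals of two vertices, each in the set belonging to the other one. -/
theorem uncross_mem_mem {v p : V} (s t : Bool) {X A : Finset V} (hvp : v ≠ p) (hX : v ∉ X)
    (hA : p ∉ A) (hp : p ∈ X) (hv : v ∈ A) :
    c.lam₂ v s p t (X ∩ A) + c.lam (X ∪ A) ≤ c.lam₁ v s X + c.lam₁ p t A := by
  have h := c.f_submod (insert (v, s) (dbl X)) (insert (p, t) (dbl A))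
  have h1 : insert (v, s) (dbl X) ∩ insert (p, t) (dbl A) =
      insert (v, s) (insert (p, t) (dbl (X ∩ A))) := by
    ext ⟨x, u⟩
    by_cases hx : x = v
    · subst hx; simp [hX, hv, hvp]
    · by_cases hx' : x = p
      · subst hx'; simp [hA, hp, hx]
      · simp [hx, hx']
  have h2 : insert (v, s) (dbl X) ∪ insert (p, t) (dbl A) = dbl (X ∪ A) := by
    ext ⟨x, u⟩
    by_cases hx : x = v
    · subst hx; simp [hv]
    · by_cases hx' : x = p
      · subst hx'; simp [hp]
      · simp [hx, hx']
  rw [h1, h2, f_half _ hX, f_half _ hA, f_half₂ _ _ (by simp [hX]) (by simp [hA]) hvp] at h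
  simp only [f_dbl] at h
  linarith

/-- Uncrossing of removals of two vertices, one of them in the set belonging to the other one. -/
theorem uncross_mem_notMem {v p : V} (s t : Bool) {X B : Finset V} (hvp : v ≠ p) (hX : v ∉ X)
    (hB : p ∉ B) (hp : p ∈ X) (hv : v ∉ B) :
    c.lam₁ p t (X ∩ B) + c.lam₁ v s (X ∪ B) ≤ c.lam₁ v s X + c.lam₁ p t B := by
  have h := c.f_submod (insert (v, s) (dbl X)) (insert (p, t) (dbl B))
  have h1 : insert (v, s) (dbl X) ∩ insert (p, t) (dbl B) = insert (p, t) (dbl (X ∩ B)) := by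
    ext ⟨x, u⟩
    by_cases hx : x = v
    · subst hx; simp [hX, hv, hvp]
    · by_cases hx' : x = p
      · subst hx'; simp [hB, hp, hx]
      · simp [hx, hx']
  have h2 : insert (v, s) (dbl X) ∪ insert (p, t) (dbl B) = insert (v, s) (dbl (X ∪ B)) := by
    ext ⟨x, u⟩
    by_cases hx : x = v
    · subst hx; simp [hX, hv, hvp]
    · by_cases hx' : x = p
      · subst hx'; simp [hp]
      · simp [hx, hx']
  rw [h1, h2, f_half _ hX, f_half _ hB, f_half _ (by simp [hB]), f_half _ (by simp [hX, hv])] at h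
  linarith

theorem uncross₂_mem {v p : V} (s t : Bool) {W T : Finset V} (hvp : v ≠ p) (hv : v ∉ W)
    (hp : p ∉ W) (hvT : v ∈ T) (hpT : p ∈ T) :
    c.lam₂ v s p t (W ∩ T) + c.lam (W ∪ T) ≤ c.lam₂ v s p t W + c.lam T := by
  have h := c.f_submod (insert (v, s) (insert (p, t) (dbl W))) (dbl T)
  have h1 : insert (v, s) (insert (p, t) (dbl W)) ∩ dbl T =
      insert (v, s) (insert (p, t) (dbl (W ∩ T))) := by
    ext ⟨x, u⟩
    by_cases hx : x = v
    · subst hx; simp [hvT]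
    · by_cases hx' : x = p
      · subst hx'; simp [hpT]
      · simp [hx, hx']
  have h2 : insert (v, s) (insert (p, t) (dbl W)) ∪ dbl T = dbl (W ∪ T) := by
    ext ⟨x, u⟩
    by_cases hx : x = v
    · subst hx; simp [hvT]
    · by_cases hx' : x = p
      · subst hx'; simp [hpT]
      · simp [hx, hx']
  rw [h1, h2, f_half₂ _ _ hv hp hvp, f_half₂ _ _ (by simp [hv]) (by simp [hp]) hvp] at h
  simp only [f_dbl] at h
  linarith

/-- Uncrossing of a removal of `v` and `p` with a removal of `q`. -/
theorem uncross₂_half {v p q : V} (s t u : Bool) {W D : Finset V} (hvp : v ≠ p) (hvq : v ≠ q)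
    (hpq : p ≠ q) (hv : v ∉ W) (hp : p ∉ W) (hq : q ∈ W) (hvD : v ∉ D) (hpD : p ∈ D)
    (hqD : q ∉ D) :
    c.lam₂ p t q u (W ∩ D) + c.lam₁ v s (W ∪ D) ≤ c.lam₂ v s p t W + c.lam₁ q u D := by
  have h := c.f_submod (insert (v, s) (insert (p, t) (dbl W))) (insert (q, u) (dbl D))
  have h1 : insert (v, s) (insert (p, t) (dbl W)) ∩ insert (q, u) (dbl D) =
      insert (p, t) (insert (q, u) (dbl (W ∩ D))) := by
    ext ⟨x, w⟩
    by_cases hx : x = v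
    · subst hx; simp [hv, hvD, hvp, hvq]
    · by_cases hx' : x = p
      · subst hx'; simp [hp, hpD, hx, hpq]
      · by_cases hx'' : x = q
        · subst hx''; simp [hx, hx', hq, hqD]
        · simp [hx, hx', hx'']
  have h2 : insert (v, s) (insert (p, t) (dbl W)) ∪ insert (q, u) (dbl D) =
      insert (v, s) (dbl (W ∪ D)) := by
    ext ⟨x, w⟩
    by_cases hx : x = v
    · subst hx; simp [hv, hvD, hvp, hvq]
    · by_cases hx' : x = p
      · subst hx'; simp [hpD]
      · by_cases hx'' : x = q
        · subst hx''; simp [hq]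
        · simp [hx, hx', hx'']
  rw [h1, h2, f_half₂ _ _ hv hp hvp, f_half₂ _ _ (by simp [hp]) (by simp [hqD]) hpq,
    f_half _ hqD, f_half _ (by simp [hv, hvD])] at h
  linarith

end HalfRank

end RankConnectivity

/-! ### Triplets and quads in a critical half-rank -/

namespace RankConnectivity

open Finset

namespace HalfRank

variable {V : Type*} [Fintype V] [DecidableEq V] (c : HalfRank V)

/-- `X` is one side of a split of what remains after the removal of `v` through `(v, s)`. -/
structure IsSplitAt (v : V) (s : Bool) (X : Finset V) : Prop where
  notMem : v ∉ X
  two_le : 2 ≤ #X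
  card_le : #X + 3 ≤ Fintype.card V
  le : c.lam₁ v s X ≤ 1

/-- `S` and `S'` are the two sides of a separation of order at most two, with at least six vertices
on each side, of what remains after the removal of `v` through `(v, s)`. -/
structure IsSep (v : V) (s : Bool) (S S' : Finset V) : Prop where
  eq_compl : S' = (insert v S)ᶜ
  notMem : v ∉ S
  six_le : 6 ≤ #S
  six_le' : 6 ≤ #S'
  le : c.lam₁ v s S ≤ 2

/-- A counterexample to the main theorem in terms of half-ranks: prime, with all separations of
order two having a side with at most four vertices, and such that removing any vertex through
either half destroys primeness or creates a separation as in `IsSep`. -/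
structure IsCritical : Prop where
  prime : ∀ X : Finset V, 2 ≤ #X → #X + 2 ≤ Fintype.card V → 2 ≤ c.lam X
  conn : ∀ X : Finset V, 5 ≤ #X → #X + 5 ≤ Fintype.card V → 3 ≤ c.lam X
  card : 10 ≤ Fintype.card V
  bad : ∀ v s, (∃ X, c.IsSplitAt v s X) ∨ ∃ S S', c.IsSep v s S S'

/-- `T` is a triplet: three vertices of connectivity two. -/
def IsTriplet (T : Finset V) : Prop := #T = 3 ∧ c.lam T ≤ 2

/-- The triplet `T` is tied to the half `(v, s)` of its vertex `v`: removing `v` through `(v, s)`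
makes the other two vertices of `T` the side of a split. -/
def IsTied (v : V) (s : Bool) (T : Finset V) : Prop :=
  c.IsTriplet T ∧ v ∈ T ∧ c.lam₁ v s (T.erase v) ≤ 1

variable {c}

theorem uncross_sdiff {v : V} (s : Bool) {X Y : Finset V} (hX : v ∉ X) (hY : v ∉ Y) :
    c.lam (X \ Y) + c.lam (Y \ X) ≤ c.lam₁ v s X + c.lam₁ v (!s) Y + 1 := by
  have h := c.uncross_same s hX (show v ∉ (insert v Y)ᶜ by simp)
  rw [lam₁_compl _ hY] at h
  have h1 : X ∩ (insert v Y)ᶜ = X \ Y := by ext x; by_cases hx : x = v <;> simp [hx, hX]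
  have h2 : insert v (X ∪ (insert v Y)ᶜ) = (Y \ X)ᶜ := by
    ext x; by_cases hx : x = v <;> simp [hx, hY]; tauto
  rwa [h1, h2, lam_compl] at h

theorem card_compl_insert {v : V} {X : Finset V} (hv : v ∉ X) :
    #(insert v X)ᶜ + #X + 1 = Fintype.card V := by
  have h := card_add_card_compl (insert v X)
  rw [card_insert_of_notMem hv] at h
  omega

namespace IsSep

variable {v : V} {s : Bool} {S S' : Finset V}

theorem card_add (h : c.IsSep v s S S') : #S' + #S + 1 = Fintype.card V := by
  rw [h.eq_compl]; exact card_compl_insert h.notMem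

theorem symm (h : c.IsSep v s S S') : c.IsSep v s S' S where
  eq_compl := by
    rw [h.eq_compl]; ext x; by_cases hx : x = v <;> simp [hx, h.notMem]
  notMem := by simp [h.eq_compl]
  six_le := h.six_le'
  six_le' := h.six_le
  le := by rw [h.eq_compl, lam₁_compl _ h.notMem]; exact h.le

theorem card_inter_add (h : c.IsSep v s S S') (Z : Finset V) :
    #(Z ∩ S) + #(Z ∩ S') = #(Z.erase v) := by
  rw [← card_union_of_disjoint]
  · congr 1
    ext x
    have := h.notMem
    simp only [h.eq_compl, mem_union, mem_inter, mem_compl, mem_insert, mem_erase]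
    grind
  · simp only [disjoint_left, h.eq_compl, mem_inter, mem_compl, mem_insert]
    tauto

theorem mem_iff (h : c.IsSep v s S S') {x : V} : x ∈ S' ↔ x ≠ v ∧ x ∉ S := by
  simp [h.eq_compl]

theorem sdiff_eq (h : c.IsSep v s S S') {X : Finset V} (hX : v ∉ X) : X \ S = X ∩ S' := by
  ext x
  simp only [mem_sdiff, mem_inter, h.mem_iff]
  grind

end IsSep

namespace IsCritical

variable (h : c.IsCritical)

include h

theorem one_le (X : Finset V) (h1 : 1 ≤ #X) (h2 : #X + 2 ≤ Fintype.card V) : 1 ≤ c.lam X := by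
  obtain ⟨v, hv⟩ : ∃ v, v ∉ X := by
    by_contra! hX
    rw [eq_univ_iff_forall.2 hX, card_univ] at h2
    omega
  have h3 := c.lam_insert_le hv
  have h4 := h.prime (insert v X)
  rw [card_insert_of_notMem hv] at h4
  have h5 := h.prime X
  have := h.card
  omega

/-- The smaller side `X` of a split after the removal of `v` has at most three vertices, since `X`
and `insert v X` have connectivity at most two. -/
theorem exists_small_split {v : V} {s : Bool} (hX : ∃ X, c.IsSplitAt v s X) :
    ∃ X, c.IsSplitAt v s X ∧ #X ≤ 3 := by
  have key : ∀ X, c.IsSplitAt v s X → #X + #X + 1 ≤ Fintype.card V → #X ≤ 3 := by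
    intro X hX hn
    have h1 := c.lam_insert_le_lam₁_add_one s hX.notMem
    have h2 := h.conn (insert v X)
    rw [card_insert_of_notMem hX.notMem] at h2
    have := hX.le
    have := h.card
    omega
  obtain ⟨X, hX⟩ := hX
  have h1 := card_compl_insert hX.notMem
  by_cases hn : #X + #X + 1 ≤ Fintype.card V
  · exact ⟨X, hX, key X hX hn⟩
  · have hX' : c.IsSplitAt v s (insert v X)ᶜ :=
      { notMem := by simp
        two_le := by have := hX.card_le; omega
        card_le := by have := hX.two_le; omega
        le := by rw [lam₁_compl _ hX.notMem]; exact hX.le }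
    exact ⟨_, hX', key _ hX' (by omega)⟩

theorem card_ne_three {v : V} {s : Bool} {X : Finset V} (hX : c.IsSplitAt v s X) : #X ≠ 3 := by
  intro h3
  have key : ∀ Y, v ∉ Y →
      (#X = #(X ∩ Y) + #(X \ Y)) ∧ (#Y = #(X ∩ Y) + #(Y \ X)) ∧
      (#(insert v (X ∪ Y)) + #(X ∩ Y) = #X + #Y + 1) ∧ #(insert v (X ∪ Y)) ≤ Fintype.card V ∧
      c.lam (X ∩ Y) + c.lam (insert v (X ∪ Y)) ≤ c.lam₁ v (!s) Y + 2 ∧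
      c.lam (X \ Y) + c.lam (Y \ X) ≤ c.lam₁ v (!s) Y + 2 := by
    intro Y hY
    have h1 := card_inter_add_card_sdiff X Y
    have h2 := card_inter_add_card_sdiff Y X
    rw [inter_comm] at h2
    have h3 : #(insert v (X ∪ Y)) = #(X ∪ Y) + 1 :=
      card_insert_of_notMem (by simp [hX.notMem, hY])
    have h4 := card_union_add_card_inter X Y
    have h5 := card_le_univ (insert v (X ∪ Y))
    have h6 := c.uncross_same s hX.notMem hY
    have h7 := c.uncross_sdiff s hX.notMem hY
    have := hX.le
    refine ⟨?_, ?_, ?_, ?_, ?_, ?_⟩ <;> omega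
  have hn := h.card
  rcases h.bad v (!s) with hY | ⟨S, S', hS⟩
  · obtain ⟨Y, hY, hY3⟩ := h.exists_small_split hY
    obtain ⟨k1, k2, k3, k4, k5, k6⟩ := key Y hY.notMem
    have a1 := h.prime (X ∩ Y)
    have a2 := h.prime (insert v (X ∪ Y))
    have a3 := h.prime (X \ Y)
    have a4 := h.prime (Y \ X)
    have a5 := h.conn (insert v (X ∪ Y))
    have a6 := h.one_le (X ∩ Y)
    have := hY.le
    have := hY.two_le
    omega
  · have key' : ∀ S S', c.IsSep v (!s) S S' → 2 ≤ #(X ∩ S) → False := by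
      intro S S' hS h2
      obtain ⟨k1, k2, k3, k4, k5, k6⟩ := key S hS.notMem
      have a1 := h.prime (X ∩ S)
      have a5 := h.conn (insert v (X ∪ S))
      have := hS.le
      have := hS.six_le
      have := hS.six_le'
      have := hS.card_add
      omega
    have k1 := (key S hS.notMem).1
    rw [hS.sdiff_eq hX.notMem] at k1
    by_cases h2 : 2 ≤ #(X ∩ S)
    · exact key' S S' hS h2
    · exact key' S' S hS.symm (by omega)

/-- A split that arises from a removal comes from a tied triplet. -/
theorem exists_tied {v : V} {s : Bool} (hX : ∃ X, c.IsSplitAt v s X) : ∃ T, c.IsTied v s T := by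
  obtain ⟨X, hX, h3⟩ := h.exists_small_split hX
  have h3' := h.card_ne_three hX
  have h2 := hX.two_le
  have h4 := c.lam_insert_le_lam₁_add_one s hX.notMem
  have := hX.le
  refine ⟨insert v X, ⟨?_, by omega⟩, by simp, ?_⟩
  · rw [card_insert_of_notMem hX.notMem]; omega
  · rw [erase_insert hX.notMem]; exact hX.le

theorem bad' (v : V) (s : Bool) : (∃ T, c.IsTied v s T) ∨ ∃ S S', c.IsSep v s S S' :=
  (h.bad v s).imp_left h.exists_tied

/-- Moving the rest of a set `Q ∋ u` of connectivity two to one side of a separation of the graph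
with `u` removed gives a separation of order two of the graph itself. -/
theorem lam₁_inter_le {u : V} {s : Bool} {S S' Q : Finset V} (hS : c.IsSep u s S S') (hu : u ∈ Q)
    (hQ : c.lam Q ≤ 2) (hc : #(S' ∩ Q) ≤ 1) : c.lam₁ u s (S ∩ Q) ≤ 1 := by
  have h1 := c.uncross_mem s hS.notMem hu
  have h2 := hS.le
  have h3 := h.conn (S ∪ Q)
  have h4 : #S ≤ #(S ∪ Q) := card_le_card subset_union_left
  have h5 : #(S ∪ Q) + #(S' \ Q) = Fintype.card V := by
    have : S' \ Q = (S ∪ Q)ᶜ := by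
      ext x
      simp only [mem_sdiff, mem_compl, mem_union, hS.mem_iff]
      grind
    rw [this, card_add_card_compl]
  have h6 := card_inter_add_card_sdiff S' Q
  have := hS.six_le
  have := hS.six_le'
  omega

/-- A set of connectivity two that meets a tied triplet only in `u` inherits the tie at `u`. -/
theorem lam₁_erase_le {u : V} {s : Bool} {T Q : Finset V} (hT : c.IsTied u s T) (hu : u ∈ Q)
    (hQ : c.lam Q ≤ 2) (hTQ : #(T ∩ Q) = 1) : c.lam₁ u s (Q.erase u) ≤ 1 := by
  obtain ⟨hT, huT, hle⟩ := hT
  have k8 : ∀ x ∈ T, x ∈ Q → x = u := fun x hx hx' =>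
    card_le_one.1 hTQ.le x (by simp [hx, hx']) u (by simp [huT, hu])
  have k9 := c.uncross_mem (X := (insert u (T.erase u))ᶜ) s (by simp) hu
  rw [lam₁_compl _ (by simp), insert_erase huT] at k9
  have e1 : Tᶜ ∩ Q = Q.erase u := by
    ext x; simp only [mem_inter, mem_compl, mem_erase]
    grind
  have e2 : Tᶜ ∪ Q = (T.erase u)ᶜ := by
    ext x; simp only [mem_union, mem_compl, mem_erase]
    grind
  rw [e1, e2, lam_compl] at k9
  have k10 := h.prime (T.erase u)
  rw [card_erase_of_mem huT] at k10
  have := hT.1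
  have := h.card
  omega

/-- A set of four vertices of connectivity two cannot exist: otherwise each of its vertices would be
tied to a triplet inside the set, and the tie at the vertex outside another such triplet would give
a split with a side of three vertices. -/
theorem not_quad {Q : Finset V} (hQ : #Q = 4) : 3 ≤ c.lam Q := by
  by_contra hlam
  have hlam : c.lam Q ≤ 2 := by omega
  have hn := h.card
  have three : ∀ u s, u ∈ Q → ¬ c.lam₁ u s (Q.erase u) ≤ 1 := fun u s hu hle =>
    h.card_ne_three (X := Q.erase u) (s := s)
      ⟨by simp, by rw [card_erase_of_mem hu]; omega, by rw [card_erase_of_mem hu]; omega, hle⟩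
      (by rw [card_erase_of_mem hu]; omega)
  have key : ∀ u s, u ∈ Q → ∃ T ⊆ Q, c.IsTied u s T := by
    intro u s hu
    rcases h.bad' u s with ⟨T, hT, huT, hT'⟩ | ⟨S, S', hS⟩
    · refine ⟨T, ?_, hT, huT, hT'⟩
      have k := card_inter_add_card_sdiff T Q
      have k1 := card_union_add_card_inter T Q
      have k2 := c.lam_submod T Q
      have k3 := h.prime (T ∩ Q)
      have k4 := h.conn (T ∪ Q)
      have k5 : 0 < #(T ∩ Q) := card_pos.2 ⟨u, by simp [huT, hu]⟩
      have := hT.1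
      have := hT.2
      by_contra hsub
      have k6 : 0 < #(T \ Q) := card_pos.2 (sdiff_nonempty.2 hsub)
      have k7 : #(T ∩ Q) = 1 := by omega
      exact absurd (h.lam₁_erase_le ⟨hT, huT, hT'⟩ hu hlam k7) (three u s hu)
    · have key' : ∀ S S', c.IsSep u s S S' → #(S' ∩ Q) ≤ 1 → ∃ T ⊆ Q, c.IsTied u s T := by
        intro S S' hS hle
        have k1 := h.lam₁_inter_le hS hu hlam hle
        have k2 := c.lam_insert_le_lam₁_add_one (v := u) (X := S ∩ Q) s (by simp [hS.notMem])
        have k3 := hS.card_inter_add Q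
        rw [inter_comm Q, inter_comm Q, card_erase_of_mem hu] at k3
        have k4 : #(S ∩ Q) ≠ 3 := h.card_ne_three (v := u) (s := s)
          ⟨by simp [hS.notMem], by omega, by omega, k1⟩
        refine ⟨insert u (S ∩ Q), insert_subset hu inter_subset_right, ⟨?_, by omega⟩, by simp, ?_⟩
        · rw [card_insert_of_notMem (by simp [hS.notMem])]; omega
        · rwa [erase_insert (by simp [hS.notMem])]
      have k3 := hS.card_inter_add Q
      rw [inter_comm Q, inter_comm Q, card_erase_of_mem hu] at k3
      by_cases hle : #(S' ∩ Q) ≤ 1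
      · exact key' S S' hS hle
      · exact key' S' S hS.symm (by omega)
  obtain ⟨u, hu⟩ : Q.Nonempty := card_pos.1 (by omega)
  obtain ⟨T, hTQ, hT, -, -⟩ := key u true hu
  obtain ⟨w, hwQ, hwT⟩ : ∃ w ∈ Q, w ∉ T := by
    by_contra! hsub
    have := card_le_card (show Q ⊆ T from hsub)
    have := hT.1
    omega
  have hTw : T = Q.erase w := by
    apply eq_of_subset_of_card_le
    · intro x hx
      exact mem_erase.2 ⟨fun hxw => hwT (hxw ▸ hx), hTQ hx⟩
    · rw [card_erase_of_mem hwQ, hT.1]; omega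
  obtain ⟨T', hTQ', hT', hw, hle⟩ := key w true hwQ
  have k := c.uncross_notMem (X := T'.erase w) true (by simp) hwT
  have e1 : T'.erase w ∩ T = T'.erase w := by
    rw [hTw, inter_eq_left]; exact erase_subset_erase _ hTQ'
  have e2 : T'.erase w ∪ T = Q.erase w := by
    rw [hTw, union_eq_right]; exact erase_subset_erase _ hTQ'
  rw [e1, e2] at k
  apply three w true hwQ
  have k1 := h.prime (T'.erase w)
  rw [card_erase_of_mem hw] at k1
  have := hT'.1
  have := hT.2
  omega

theorem card_le_three {X : Finset V} (hX : c.lam X ≤ 2) (hn : #X + 5 ≤ Fintype.card V) :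
    #X ≤ 3 := by
  have h1 := h.conn X
  have h2 := h.not_quad (Q := X)
  omega

theorem card_inter_ne_two {T T' : Finset V} (hT : c.IsTriplet T) (hT' : c.IsTriplet T') :
    #(T ∩ T') ≠ 2 := by
  intro h2
  have h3 := c.lam_submod T T'
  have h4 := h.prime (T ∩ T')
  have h5 := card_union_add_card_inter T T'
  have h6 := h.not_quad (Q := T ∪ T')
  have := h.card
  have := hT.1
  have := hT.2
  have := hT'.1
  have := hT'.2
  omega

theorem not_tied_both {v : V} {s : Bool} {T : Finset V} (hT : c.IsTied v s T) :
    ¬ c.IsTied v (!s) T := by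
  intro hT'
  have h1 := c.uncross_same (v := v) (X := T.erase v) (Y := T.erase v) s (by simp) (by simp)
  rw [inter_self, union_self, insert_erase hT.2.1] at h1
  have h2 := h.prime (T.erase v)
  rw [card_erase_of_mem hT.2.1] at h2
  have h3 := h.prime T
  have := hT.1.1
  have := hT.2.2
  have := hT'.2.2
  have := h.card
  omega

/-- A triplet has a separation at each of its vertices. -/
theorem exists_sep_of_triplet {u : V} {T : Finset V} (hT : c.IsTriplet T) (hu : u ∈ T) :
    ∃ s, ¬ c.IsTied u s T ∧ ∃ S S', c.IsSep u s S S' := by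
  obtain ⟨s, hs⟩ : ∃ s, ¬ c.IsTied u s T := by
    by_cases ht : c.IsTied u true T
    · exact ⟨!true, h.not_tied_both ht⟩
    · exact ⟨true, ht⟩
  refine ⟨s, hs, (h.bad' u s).resolve_left ?_⟩
  rintro ⟨T', hT', huT', hle⟩
  have hTc := hT.1
  have hTc' := hT'.1
  have k1 := h.card_inter_ne_two hT' hT
  have k5 : 0 < #(T' ∩ T) := card_pos.2 ⟨u, by simp [huT', hu]⟩
  have k6 : #(T' ∩ T) ≤ 3 := (card_le_card inter_subset_left).trans hTc'.le
  by_cases k7 : #(T' ∩ T) = 3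
  · have e1 : T' ∩ T = T' := eq_of_subset_of_card_le inter_subset_left (by omega)
    have e2 : T' ∩ T = T := eq_of_subset_of_card_le inter_subset_right (by omega)
    exact hs ((e1.symm.trans e2) ▸ ⟨hT', huT', hle⟩)
  · have k7 : #(T' ∩ T) = 1 := by omega
    exact hs ⟨hT, hu, h.lam₁_erase_le ⟨hT', huT', hle⟩ hu hT.2 k7⟩

/-- Without triplets the cells formed by the separations for the two removals of a vertex would have
two vertices at most if their connectivity is two, which leaves a side with too few vertices. -/
theorem exists_triplet : ∃ T, c.IsTriplet T := by
  by_contra! hno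
  have hn := h.card
  have two : ∀ X : Finset V, c.lam X ≤ 2 → #X + 5 ≤ Fintype.card V → #X ≤ 2 := by
    intro X hX hc
    have h1 := h.card_le_three hX hc
    have h2 : #X ≠ 3 := fun h3 => hno X ⟨h3, hX⟩
    omega
  obtain ⟨v⟩ : Nonempty V := Fintype.card_pos_iff.1 (by omega)
  have sep : ∀ s, ∃ S S', c.IsSep v s S S' := fun s =>
    (h.bad' v s).resolve_left fun ⟨T, hT⟩ => hno T hT.1
  obtain ⟨X, X', hX⟩ := sep true
  obtain ⟨Y, Y', hY⟩ := sep false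
  have k1 := c.uncross_same true hX.notMem hY.notMem
  have k2 := c.uncross_sdiff true hX.notMem hY.notMem
  have e : (insert v (X ∪ Y)) = (X' ∩ Y')ᶜ := by
    ext x
    simp only [mem_insert, mem_union, mem_compl, mem_inter, hX.mem_iff, hY.mem_iff]
    tauto
  rw [e, lam_compl] at k1
  have l1 := two (X ∩ Y)
  have l2 := two (X' ∩ Y')
  have l3 := two (X \ Y)
  have l4 := two (Y \ X)
  have e1 : X \ Y = X ∩ Y' := hY.sdiff_eq hX.notMem
  have e2 : Y \ X = Y ∩ X' := hX.sdiff_eq hY.notMem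
  have s1 := hY.card_inter_add X
  have s2 := hX.card_inter_add Y
  have s3 := hY.card_inter_add X'
  have s4 := hX.card_inter_add Y'
  rw [erase_eq_of_notMem hX.notMem, ← e1] at s1
  rw [erase_eq_of_notMem hY.notMem, ← e2, inter_comm] at s2
  rw [erase_eq_of_notMem hX.symm.notMem, inter_comm, ← e2] at s3
  rw [erase_eq_of_notMem hY.symm.notMem, inter_comm, inter_comm Y', ← e1] at s4
  have := hX.six_le
  have := hX.six_le'
  have := hY.six_le
  have := hY.six_le'
  have := hX.card_add
  have := hX.le
  have := hY.le
  simp only [Bool.not_true] at k1 k2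
  omega

end IsCritical

end HalfRank

end RankConnectivity

/-! ### Separations crossing at a triplet -/

namespace RankConnectivity

open Finset

namespace HalfRank

variable {V : Type*} [Fintype V] [DecidableEq V] (c : HalfRank V)

/-- A separation at the vertex `v` of a triplet `T = {v, p, q}`, through a half to which `T` is not
tied, with `p` on the side `X` and `q` on the side `Y`. -/
structure Crossing (T : Finset V) (v p q : V) (s : Bool) (X Y : Finset V) : Prop where
  sep : c.IsSep v s X Y
  triplet : c.IsTriplet T
  eq : T = {v, p, q}
  not_tied : ¬ c.IsTied v s T
  mem : p ∈ X
  mem' : q ∈ Y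

variable {c}

namespace IsSep

variable {v : V} {s : Bool} {S S' : Finset V}

theorem card_inter_add_of_notMem (h : c.IsSep v s S S') {Z : Finset V} (hZ : v ∉ Z) :
    #(Z ∩ S) + #(Z ∩ S') = #Z := by
  rw [h.card_inter_add, erase_eq_of_notMem hZ]

theorem card_inter_add_of_mem (h : c.IsSep v s S S') {Z : Finset V} (hZ : v ∈ Z) :
    #(Z ∩ S) + #(Z ∩ S') + 1 = #Z := by
  rw [h.card_inter_add, card_erase_add_one hZ]

end IsSep

namespace Crossing

variable {T X Y A B C D : Finset V} {v p q : V} {s t u : Bool}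

theorem symm (hX : c.Crossing T v p q s X Y) : c.Crossing T v q p s Y X where
  sep := hX.sep.symm
  triplet := hX.triplet
  eq := by rw [hX.eq, pair_comm]
  not_tied := hX.not_tied
  mem := hX.mem'
  mem' := hX.mem

theorem notMem (hX : c.Crossing T v p q s X Y) : q ∉ X := (hX.sep.mem_iff.1 hX.mem').2

theorem notMem' (hX : c.Crossing T v p q s X Y) : p ∉ Y := hX.symm.notMem

theorem ne (hX : c.Crossing T v p q s X Y) : v ≠ p := fun e => hX.sep.notMem (e ▸ hX.mem)

theorem ne' (hX : c.Crossing T v p q s X Y) : v ≠ q := hX.symm.ne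

theorem two_le_lam₁ (hX : c.Crossing T v p q s X Y) : 2 ≤ c.lam₁ v s (T.erase v) := by
  by_contra hlt
  exact hX.not_tied ⟨hX.triplet, by simp [hX.eq], by omega⟩

theorem lam_le_lam₁ (hX : c.Crossing T v p q s X Y) {Z : Finset V} (hZ : Disjoint T Z) :
    c.lam Z ≤ c.lam₁ v s Z := by
  have hv : v ∈ T := by simp [hX.eq]
  have hvZ : v ∉ Z := disjoint_left.1 hZ hv
  have k := c.uncross_mem (X := (insert v Z)ᶜ) s (by simp) hv
  have e1 : (insert v Z)ᶜ ∩ T = T.erase v := by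
    ext x
    have : x ∈ T → x ∉ Z := fun hx => disjoint_left.1 hZ hx
    simp only [mem_inter, mem_compl, mem_insert, mem_erase]
    tauto
  have e2 : (insert v Z)ᶜ ∪ T = Zᶜ := by
    ext x
    have : x ∈ T → x ∉ Z := fun hx => disjoint_left.1 hZ hx
    simp only [mem_union, mem_compl, mem_insert]
    grind
  rw [e1, e2, lam_compl, lam₁_compl _ hvZ] at k
  have := hX.two_le_lam₁
  have := hX.triplet.2
  omega

theorem lam_le_lam₂_add_one (hX : c.Crossing T v p q s X Y) (t : Bool) {Z : Finset V}
    (hZ : Disjoint T Z) : c.lam Z ≤ c.lam₂ v s p t Z + 1 := by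
  have hv : v ∈ T := by simp [hX.eq]
  have hp : p ∈ T := by simp [hX.eq]
  have hvp := hX.ne
  have k := c.uncross₂_mem (W := (insert v (insert p Z))ᶜ) s t hvp (by simp) (by simp) hv hp
  have e1 : (insert v (insert p Z))ᶜ ∩ T = (T.erase v).erase p := by
    ext x
    have : x ∈ T → x ∉ Z := fun hx => disjoint_left.1 hZ hx
    simp only [mem_inter, mem_compl, mem_insert, mem_erase]
    tauto
  have e2 : (insert v (insert p Z))ᶜ ∪ T = Zᶜ := by
    ext x
    have : x ∈ T → x ∉ Z := fun hx => disjoint_left.1 hZ hx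
    simp only [mem_union, mem_compl, mem_insert]
    grind
  rw [e1, e2, lam_compl, lam₂_compl _ _ (disjoint_left.1 hZ hv) (disjoint_left.1 hZ hp) hvp] at k
  have k' := c.lam₁_insert_le_lam₂_add_one v s (w := p) t (X := (T.erase v).erase p) (by simp)
  rw [insert_erase (mem_erase.2 ⟨hvp.symm, hp⟩)] at k'
  have := hX.two_le_lam₁
  have := hX.triplet.2
  omega

theorem lam_add_lam_le_four (hX : c.Crossing T v p q s X Y) (hA : c.Crossing T p v q t A B) :
    c.lam (X ∩ B) + c.lam (Y ∩ A) ≤ 4 := by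
  have k := c.uncross_mem_notMem s t hX.ne hX.sep.notMem hA.sep.symm.notMem hX.mem hA.notMem'
  have e : (insert v (X ∪ B))ᶜ = Y ∩ A := by
    ext x
    simp only [mem_compl, mem_insert, mem_union, mem_inter, hX.sep.mem_iff, hA.sep.symm.mem_iff]
    have := hX.mem
    grind
  rw [← lam₁_compl (X := X ∪ B) s (by simp [hX.sep.notMem, hA.notMem']), e] at k
  have k1 := hA.lam_le_lam₁ (Z := X ∩ B) <| by
    rw [hA.eq]
    simp [hA.sep.symm.notMem, hA.notMem', hX.notMem]
  have k2 := hX.lam_le_lam₁ (Z := Y ∩ A) <| by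
    rw [hX.eq]
    simp [hX.sep.symm.notMem, hA.notMem, hX.notMem']
  have := hX.sep.le
  have := hA.sep.symm.le
  omega

theorem lam₂_add_lam_le_four (hX : c.Crossing T v p q s X Y) (hA : c.Crossing T p v q t A B) :
    c.lam₂ v s p t (X ∩ A) + c.lam (Y ∩ B) ≤ 4 := by
  have k := c.uncross_mem_mem s t hX.ne hX.sep.notMem hA.sep.notMem hX.mem hA.mem
  have e : (X ∪ A)ᶜ = Y ∩ B := by
    ext x
    simp only [mem_compl, mem_union, mem_inter, hX.sep.mem_iff, hA.sep.mem_iff]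
    have := hX.mem
    have := hA.mem
    grind
  rw [← lam_compl (X ∪ A), e] at k
  have := hX.sep.le
  have := hA.sep.le
  omega

theorem disjoint_inter (hX : c.Crossing T v p q s X Y) (hA : c.Crossing T p v q t A B) :
    Disjoint T (X ∩ A) := by
  rw [hX.eq]
  simp [hX.sep.notMem, hA.sep.notMem, hX.notMem]

theorem card_eqs (hX : c.Crossing T v p q s X Y) (hA : c.Crossing T p v q t A B) :
    #X = #(X ∩ A) + #(X ∩ B) + 1 ∧ #Y = #(Y ∩ A) + #(Y ∩ B) := by
  have h1 := hA.sep.card_inter_add_of_mem hX.mem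
  have h2 := hA.sep.card_inter_add_of_notMem hX.notMem'
  omega

/-- The side at `v` that contains `p` and the side at `p` that does not contain `v` meet in two or
three vertices. -/
theorem card_inter_bounds (h : c.IsCritical) (hX : c.Crossing T v p q s X Y)
    (hA : c.Crossing T p v q t A B) :
    2 ≤ #(X ∩ B) ∧ #(X ∩ B) ≤ 3 ∧ c.lam (X ∩ B) ≤ 2 := by
  have key : ∀ {v p s t X Y A B}, c.Crossing T v p q s X Y → c.Crossing T p v q t A B →
      2 ≤ #(X ∩ B) := by
    intro v p s t X Y A B hX hA
    by_contra hlt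
    have h1 := hX.lam₂_add_lam_le_four hA
    have h2 := hX.lam_le_lam₂_add_one t (hX.disjoint_inter hA)
    have h3 := hX.card_eqs hA
    have h4 := hA.card_eqs hX
    rw [inter_comm B, inter_comm B] at h4
    have h5 := h.card_le_three (X := X ∩ A)
    have h6 := h.card_le_three (X := Y ∩ B)
    have := hX.sep.six_le
    have := hA.sep.six_le'
    have := hX.sep.card_add
    omega
  have h1 := key hX hA
  have h2 := key hA hX
  rw [inter_comm] at h2
  have h3 := hX.lam_add_lam_le_four hA
  have h4 := card_le_card (inter_subset_left (s₁ := X) (s₂ := B))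
  have h5 := card_le_card (inter_subset_left (s₁ := Y) (s₂ := A))
  have h6 := h.prime (Y ∩ A)
  have h7 := h.card_le_three (X := X ∩ B)
  have := hX.sep.six_le'
  have := hX.sep.card_add
  omega

/-- Uncrossing the separations at all three vertices of a triplet: the set `X ∩ A`, of connectivity
one after the removal of `v` and `p` if `λ(Y ∩ B)` is at least three, with the separation at `q`. -/
theorem lam_add_lam_le_of_three_le (hX : c.Crossing T v p q s X Y) (hA : c.Crossing T p v q t A B)
    (hC : c.Crossing T q v p u C D) (h3 : 3 ≤ c.lam (Y ∩ B)) :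
    c.lam ((D \ (X ∩ A)).erase p) + c.lam (X ∩ A ∩ C) ≤ 4 := by
  have k := c.uncross₂_half (W := (insert v (insert p (X ∩ A)))ᶜ) (D := D) s t u hX.ne hX.ne'
    hA.ne' (by simp) (by simp) (by simp [hX.ne'.symm, hA.ne'.symm, hX.notMem]) hC.notMem' hC.mem'
    hC.sep.symm.notMem
  have hv := hX.sep.notMem
  have hp := hA.sep.notMem
  rw [lam₂_compl _ _ (by simp [hv]) (by simp [hp]) hX.ne] at k
  have e1 : (insert v (insert p (X ∩ A)))ᶜ ∩ D = (D \ (X ∩ A)).erase p := by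
    ext x
    have := hC.notMem'
    simp only [mem_inter, mem_compl, mem_insert, mem_erase, mem_sdiff]
    grind
  have e2 : (insert v (insert p (X ∩ A)))ᶜ ∪ D = (insert v (X ∩ A ∩ C))ᶜ := by
    ext x
    have := hC.notMem'
    have := hC.mem'
    have := hX.notMem
    simp only [mem_inter, mem_compl, mem_insert, mem_union, hC.sep.mem_iff] at *
    grind
  rw [e1, e2, lam₁_compl _ (by simp [hv])] at k
  have k1 := hX.lam_le_lam₁ (Z := X ∩ A ∩ C)
    ((hX.disjoint_inter hA).mono_right inter_subset_left)
  have k2 := hA.symm.lam_le_lam₂_add_one u (Z := (D \ (X ∩ A)).erase p) <| by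
    rw [hX.eq]
    simp [hC.notMem', hC.sep.symm.notMem]
  have k3 := hX.lam₂_add_lam_le_four hA
  have := hC.sep.symm.le
  omega

theorem card_le_one_of_three_le (h : c.IsCritical) (hX : c.Crossing T v p q s X Y)
    (hA : c.Crossing T p v q t A B) (hC : c.Crossing T q v p u C D) (h3 : 3 ≤ c.lam (Y ∩ B)) :
    #(X ∩ A) ≤ 3 ∧ #(X ∩ A ∩ C) ≤ 1 := by
  have k1 := hX.lam_add_lam_le_of_three_le hA hC h3
  have k2 := hX.lam_le_lam₂_add_one t (hX.disjoint_inter hA)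
  have k3 := hX.lam₂_add_lam_le_four hA
  have k4 := h.card_le_three (X := X ∩ A)
  have k5 := h.card_le_three (X := (D \ (X ∩ A)).erase p)
  have k6 := h.prime (X ∩ A ∩ C)
  have k7 : #((D \ (X ∩ A)).erase p) + 1 + #(X ∩ A ∩ D) = #D := by
    rw [card_erase_add_one (by simp [hC.mem', hA.sep.notMem]), inter_comm (X ∩ A), add_comm,
      card_inter_add_card_sdiff]
  have k8 := hC.sep.card_inter_add_of_notMem (Z := X ∩ A) (by simp [hX.notMem])
  have l1 := card_le_card (inter_subset_left (s₁ := X) (s₂ := A))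
  have := hX.sep.six_le'
  have := hX.sep.card_add
  have := hC.sep.six_le
  have := hC.sep.six_le'
  have := hC.sep.card_add
  omega

theorem card_eq_of_three_le (h : c.IsCritical) (hX : c.Crossing T v p q s X Y)
    (hA : c.Crossing T p v q t A B) (hC : c.Crossing T q v p u C D) (h3 : 3 ≤ c.lam (Y ∩ B)) :
    #(X ∩ A ∩ C) = 1 ∧ #(X ∩ A ∩ D) = 1 ∧ #(X ∩ B) = 3 ∧ #(Y ∩ A) = 3 := by
  have k1 := hX.card_le_one_of_three_le h hA hC h3
  have k2 := hA.card_le_one_of_three_le h hX hC.symm (by rwa [inter_comm])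
  have k3 := hC.sep.card_inter_add_of_notMem (Z := X ∩ A) (by simp [hX.notMem])
  have k4 := hX.card_eqs hA
  have k5 := hA.card_eqs hX
  have k6 := hX.card_inter_bounds h hA
  have k7 := hA.card_inter_bounds h hX
  rw [inter_comm A X] at k2 k5
  rw [inter_comm A Y] at k5 k7
  have := hX.sep.six_le
  have := hA.sep.six_le
  omega

theorem lam_inter_le_two (h : c.IsCritical) (hX : c.Crossing T v p q s X Y)
    (hA : c.Crossing T p v q t A B) (hC : c.Crossing T q v p u C D) : c.lam (Y ∩ B) ≤ 2 := by
  by_contra hlt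
  obtain ⟨a1, a2, a3, a4⟩ := hX.card_eq_of_three_le h hA hC (by omega)
  have b1 := hX.card_inter_bounds h hA
  have b2 := hA.card_inter_bounds h hX
  have b4 := hC.card_inter_bounds h hX.symm
  have b6 := hC.symm.card_inter_bounds h hA.symm
  rw [inter_comm] at b2
  -- the triplets `X ∩ B` and `X ∩ C`, and likewise `Y ∩ A` and `A ∩ D`, do not meet in two vertices
  have c1 : #(X ∩ C) = #(X ∩ A ∩ C) + #(X ∩ B ∩ C) := by
    rw [← hA.sep.card_inter_add_of_notMem (Z := X ∩ C) (by simp [hC.notMem]),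
      inter_right_comm, inter_right_comm X C]
  have c2 : #(X ∩ B) = #(X ∩ B ∩ C) + #(X ∩ B ∩ D) := by
    rw [← hC.sep.card_inter_add_of_notMem (Z := X ∩ B) (by simp [hX.notMem])]
  have c3 : #(X ∩ D) = #(X ∩ A ∩ D) + #(X ∩ B ∩ D) + 1 := by
    rw [← hA.sep.card_inter_add_of_mem (Z := X ∩ D) (by simp [hC.mem', hX.mem]),
      inter_right_comm, inter_right_comm X D]
  have c4 : #(A ∩ D) = #(X ∩ A ∩ D) + #(Y ∩ A ∩ D) := by
    rw [← hX.sep.card_inter_add_of_notMem (Z := A ∩ D) (by simp [hC.notMem']),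
      inter_comm _ X, inter_comm _ Y, inter_assoc, inter_assoc]
  have c5 : #(Y ∩ A) = #(Y ∩ A ∩ C) + #(Y ∩ A ∩ D) := by
    rw [← hC.sep.card_inter_add_of_notMem (Z := Y ∩ A) (by simp [hA.notMem])]
  have e1 : X ∩ C ∩ (X ∩ B) = X ∩ B ∩ C := by grind
  have e2 : A ∩ D ∩ (Y ∩ A) = Y ∩ A ∩ D := by grind
  have t1 : #(X ∩ C) = 3 → #(X ∩ B ∩ C) ≠ 2 := fun hc => by
    rw [← e1]
    refine h.card_inter_ne_two ⟨hc, ?_⟩ ⟨a3, b1.2.2⟩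
    rw [inter_comm]; exact b4.2.2
  have t2 : #(A ∩ D) = 3 → #(Y ∩ A ∩ D) ≠ 2 := fun hc => by
    rw [← e2]
    refine h.card_inter_ne_two ⟨hc, ?_⟩ ⟨a4, b2.2.2⟩
    rw [inter_comm]; exact b6.2.2
  have d4 := h.card_le_three (X := X ∩ D)
  have d5 := hX.sep.six_le'
  have d6 := hX.sep.card_add
  have d7 := card_le_card (inter_subset_left (s₁ := X) (s₂ := D))
  rw [inter_comm C] at b4
  rw [inter_comm D] at b6
  obtain ⟨f1, -, -, -⟩ := hX.symm.card_eq_of_three_le h hC hA (by omega)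
  rw [inter_right_comm] at f1
  omega

theorem false (h : c.IsCritical) (hX : c.Crossing T v p q s X Y) (hA : c.Crossing T p v q t A B)
    (hC : c.Crossing T q v p u C D) : False := by
  have a1 := hX.lam_inter_le_two h hA hC
  have a2 := hX.symm.lam_inter_le_two h hC hA
  have b1 := hX.card_inter_bounds h hA
  have b2 := hA.card_inter_bounds h hX
  have b3 := hX.symm.card_inter_bounds h hC
  have b4 := hC.card_inter_bounds h hX.symm
  have b5 := hA.symm.card_inter_bounds h hC.symm
  have k1 := hX.card_eqs hA
  have k2 := hX.symm.card_eqs hC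
  have k4 := hA.card_eqs hX
  have k5 := hC.card_eqs hX.symm
  rw [inter_comm A] at b2
  rw [inter_comm C] at b4
  rw [inter_comm B X, inter_comm B Y] at k4
  rw [inter_comm D X, inter_comm D Y] at k5
  have c1 : #(Y ∩ B) = 3 ∧ #(X ∩ B) = 3 ∧ #(X ∩ D) = 3 ∧ #(X ∩ C) = 3 ∧ #(Y ∩ D) = 3 := by
    have k1 := h.card_le_three a1
    have k2 := h.card_le_three a2
    have := hX.sep.six_le
    have := hX.sep.card_add
    have := hA.sep.six_le'
    have := hC.sep.six_le'
    omega
  obtain ⟨m1, m2, m3, m4, m5⟩ := c1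
  have d1 : #(X ∩ B) = #(X ∩ B ∩ C) + #(X ∩ B ∩ D) := by
    rw [← hC.sep.card_inter_add_of_notMem (Z := X ∩ B) (by simp [hX.notMem])]
  have d2 : #(X ∩ D) = #(X ∩ A ∩ D) + #(X ∩ B ∩ D) + 1 := by
    rw [← hA.sep.card_inter_add_of_mem (Z := X ∩ D) (by simp [hC.mem', hX.mem]),
      inter_right_comm, inter_right_comm X D]
  have d3 : #(B ∩ C) = #(X ∩ B ∩ C) + #(Y ∩ B ∩ C) := by
    rw [← hX.sep.card_inter_add_of_notMem (Z := B ∩ C) (by simp [hA.notMem']),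
      inter_comm _ X, inter_comm _ Y, inter_assoc, inter_assoc]
  have d4 : #(Y ∩ B) = #(Y ∩ B ∩ C) + #(Y ∩ B ∩ D) + 1 := by
    rw [← hC.sep.card_inter_add_of_mem (Z := Y ∩ B) (by simp [hX.mem', hA.mem'])]
  have e1 : X ∩ B ∩ (X ∩ D) = X ∩ B ∩ D := by grind
  have e2 : X ∩ B ∩ (X ∩ C) = X ∩ B ∩ C := by grind
  have e3 : Y ∩ B ∩ (Y ∩ D) = Y ∩ B ∩ D := by grind
  have t1 := h.card_inter_ne_two ⟨m2, b1.2.2⟩ ⟨m3, a2⟩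
  have t2 := h.card_inter_ne_two ⟨m2, b1.2.2⟩ ⟨m4, b4.2.2⟩
  have t3 := h.card_inter_ne_two ⟨m1, a1⟩ ⟨m5, b3.2.2⟩
  rw [e1] at t1
  rw [e2] at t2
  rw [e3] at t3
  omega

end Crossing

/-- The separation at a vertex of a triplet separates the two other vertices of the triplet. -/
theorem IsCritical.exists_crossing (h : c.IsCritical) {T : Finset V} (hT : c.IsTriplet T)
    {v p q : V} (hTe : T = {v, p, q}) : ∃ s X Y, c.Crossing T v p q s X Y := by
  have hv : v ∈ T := by simp [hTe]
  have hcard : #T = 3 := hT.1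
  have hvp : v ≠ p := by
    rintro rfl; have := card_le_two (a := v) (b := q); simp [hTe] at hcard; omega
  have hvq : v ≠ q := by
    rintro rfl; have := card_le_two (a := p) (b := v); simp [hTe, insert_comm v p] at hcard; omega
  obtain ⟨s, hs, S, S', hS⟩ := h.exists_sep_of_triplet hT hv
  have key : ∀ S S', c.IsSep v s S S' → p ∈ S → c.Crossing T v p q s S S' := by
    intro S S' hS hp
    refine ⟨hS, hT, hTe, hs, hp, ?_⟩
    by_contra hq
    have hqS : q ∈ S := by
      by_contra hq'
      exact hq (hS.mem_iff.2 ⟨hvq.symm, hq'⟩)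
    have e1 : S ∩ T = T.erase v := by
      rw [hTe]
      ext x
      have := hS.notMem
      simp only [mem_inter, mem_erase, mem_insert, mem_singleton]
      grind
    have e2 : S' ∩ T = ∅ := by
      rw [hTe]
      ext x
      simp only [mem_inter, hS.mem_iff, mem_insert, mem_singleton, notMem_empty]
      grind
    have k := h.lam₁_inter_le hS hv hT.2 (by simp [e2])
    rw [e1] at k
    exact hs ⟨hT, hv, k⟩
  by_cases hp : p ∈ S
  · exact ⟨s, S, S', key S S' hS hp⟩
  · exact ⟨s, S', S, key S' S hS.symm (hS.mem_iff.2 ⟨hvp.symm, hp⟩)⟩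

theorem not_isCritical : ¬ c.IsCritical := by
  intro h
  obtain ⟨T, hT⟩ := h.exists_triplet
  obtain ⟨v, p, q, -, -, -, hTe⟩ := card_eq_three.1 hT.1
  obtain ⟨s, X, Y, hX⟩ := h.exists_crossing hT hTe
  obtain ⟨t, A, B, hA⟩ := h.exists_crossing hT (v := p) (p := v) (q := q)
    (by rw [hTe, insert_comm])
  obtain ⟨u, C, D, hC⟩ := h.exists_crossing hT (v := q) (p := v) (q := p)
    (by rw [hTe]; ext x; simp; tauto)
  exact hX.false h hA hC

end HalfRank

end RankConnectivity

/-! ### The half-rank of a graph, and pivoting -/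

namespace RankConnectivity

open Finset

variable {V : Type*}

theorem pairRank_comm [Fintype V] (G : SimpleGraph V) (X Y : Finset V) :
    pairRank G X Y = pairRank G Y X := by
  classical
  simp only [pairRank]
  rw [← Matrix.rank_transpose, Matrix.transpose_submatrix, SimpleGraph.transpose_adjMatrix]

theorem pairRank_comap [Fintype V] (G : SimpleGraph V) (S : Finset V) (X Y : Finset S) :
    pairRank (G.comap fun s : S => (s : V)) X Y =
      pairRank G (X.map (.subtype _)) (Y.map (.subtype _)) := by
  classical
  have e : ∀ X : Finset S, ∃ e : X ≃ (X.map (.subtype (· ∈ S)) : Finset V),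
      ∀ x, ((e x : V)) = ((x : S) : V) := fun X =>
    ⟨X.equivMap (.subtype _), fun x => rfl⟩
  obtain ⟨eX, hX⟩ := e X
  obtain ⟨eY, hY⟩ := e Y
  simp only [pairRank]
  rw [← Matrix.rank_submatrix _ eX eY, Matrix.submatrix_submatrix]
  congr 1
  ext a b
  simp [SimpleGraph.adjMatrix_apply, hX, hY]

section Vec

variable [DecidableEq V]

open scoped Classical in
/-- The vectors representing the half-vertices: the standard basis vector of `v` for `(v, true)`,
the column of `v` in the adjacency matrix for `(v, false)`. -/
noncomputable def halfVec (G : SimpleGraph V) : V × Bool → V → ZMod 2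
  | (v, true) => Pi.single v 1
  | (v, false) => fun u => if G.Adj u v then 1 else 0

/-- The rank of a set of half-vertices in the representation `halfVec`. -/
noncomputable def halfRk (G : SimpleGraph V) (A : Finset (V × Bool)) : ℕ :=
  Module.finrank (ZMod 2) (Submodule.span (ZMod 2) (halfVec G '' (A : Set (V × Bool))))

variable [Fintype V]

theorem halfRk_mono (G : SimpleGraph V) {A B : Finset (V × Bool)} (h : A ⊆ B) :
    halfRk G A ≤ halfRk G B :=
  Submodule.finrank_mono (Submodule.span_mono (Set.image_mono (by exact_mod_cast h)))

theorem halfRk_submod (G : SimpleGraph V) (A B : Finset (V × Bool)) :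
    halfRk G (A ∩ B) + halfRk G (A ∪ B) ≤ halfRk G A + halfRk G B := by
  have h := Submodule.finrank_sup_add_finrank_inf_eq
    (Submodule.span (ZMod 2) (halfVec G '' (A : Set (V × Bool))))
    (Submodule.span (ZMod 2) (halfVec G '' (B : Set (V × Bool))))
  rw [← Submodule.span_union, ← Set.image_union, ← coe_union] at h
  have h' : halfRk G (A ∩ B) ≤ _ := Submodule.finrank_mono
    (le_inf (Submodule.span_mono (R := ZMod 2) (Set.image_mono (f := halfVec G)
      (s := ((A ∩ B : Finset _) : Set (V × Bool))) (t := A) (by simp)))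
    (Submodule.span_mono (R := ZMod 2) (Set.image_mono (f := halfVec G)
      (s := ((A ∩ B : Finset _) : Set (V × Bool))) (t := B) (by simp))))
  unfold halfRk at *
  omega

theorem halfRk_insert_le (G : SimpleGraph V) (e : V × Bool) (A : Finset (V × Bool)) :
    halfRk G (insert e A) ≤ halfRk G A + 1 := by
  have h := halfRk_submod G {e} A
  have h' : halfRk G {e} ≤ 1 := by
    unfold halfRk
    rw [coe_singleton, Set.image_singleton]
    exact (finrank_span_le_card _).trans (by simp)
  rw [← insert_eq] at h
  omega

/-- The vertices whose half `s` belongs to `A`. -/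
def halfSet (s : Bool) (A : Finset (V × Bool)) : Finset V := univ.filter fun v => (v, s) ∈ A

@[simp] theorem mem_halfSet {s : Bool} {A : Finset (V × Bool)} {v : V} :
    v ∈ halfSet s A ↔ (v, s) ∈ A := by simp [halfSet]

theorem card_halfSet_add (A : Finset (V × Bool)) :
    #(halfSet true A) + #(halfSet false A) = #A := by
  have h : A = (halfSet true A ×ˢ {true}) ∪ (halfSet false A ×ˢ {false}) := by
    ext ⟨v, s⟩; cases s <;> simp
  conv_rhs => rw [h]
  rw [card_union_of_disjoint]
  · simp
  · simp [disjoint_left]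

theorem halfRk_eq (G : SimpleGraph V) (A : Finset (V × Bool)) :
    halfRk G A = #(halfSet true A) + pairRank G (halfSet true A)ᶜ (halfSet false A) := by
  classical
  set P := halfSet true A
  set W := Submodule.span (ZMod 2) (halfVec G '' (A : Set (V × Bool))) with hW
  -- restriction of vectors to the coordinates outside `P`; its kernel is spanned by basis vectors
  let π : (V → ZMod 2) →ₗ[ZMod 2] ((Pᶜ : Finset V) → ZMod 2) :=
    LinearMap.funLeft (ZMod 2) (ZMod 2) (fun x => (x : V))
  have hπ : Function.Surjective π :=
    LinearMap.funLeft_surjective_of_injective _ _ _ Subtype.val_injective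
  have hker : LinearMap.ker π ≤ W := by
    intro x hx
    rw [pi_eq_sum_univ' x]
    refine Submodule.sum_mem _ fun u _ => ?_
    by_cases hu : u ∈ P
    · refine Submodule.smul_mem _ _ (Submodule.subset_span ⟨(u, true), by simpa [P] using hu, ?_⟩)
      ext y; simp [halfVec, Pi.single_apply, eq_comm]
    · have : x u = 0 := congrFun (LinearMap.mem_ker.1 hx) ⟨u, by simpa using hu⟩
      rw [this, zero_smul]; exact W.zero_mem
  have h1 := LinearMap.finrank_range_add_finrank_ker π
  rw [LinearMap.range_eq_top.2 hπ, finrank_top, Module.finrank_pi, Module.finrank_pi] at h1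
  have h2 := LinearMap.finrank_range_add_finrank_ker (π.domRestrict W)
  have h3 : LinearMap.ker (π.domRestrict W) = (LinearMap.ker π).submoduleOf W := by
    ext x; simp [Submodule.submoduleOf]
  rw [h3, (Submodule.submoduleOfEquivOfLe hker).finrank_eq, LinearMap.range_domRestrict] at h2
  have h4 : W.map π = Submodule.span (ZMod 2) (Set.range (Matrix.col
      ((G.adjMatrix (ZMod 2)).submatrix (fun x : (Pᶜ : Finset V) => (x : V))
        (fun y : halfSet false A => (y : V))))) := by
    rw [hW, Submodule.map_span]
    apply le_antisymm
    · rw [Submodule.span_le]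
      rintro _ ⟨_, ⟨⟨u, s⟩, hu, rfl⟩, rfl⟩
      cases s
      · refine Submodule.subset_span ⟨⟨u, by simpa using hu⟩, ?_⟩
        ext y
        simp [π, LinearMap.funLeft, halfVec, Matrix.col, SimpleGraph.adjMatrix_apply]
      · have : π (halfVec G (u, true)) = 0 := by
          ext ⟨y, hy⟩
          have : y ≠ u := by
            rintro rfl
            exact (mem_compl.1 hy) (by simpa [P] using hu)
          simp [π, LinearMap.funLeft, halfVec, this]
        rw [this]; exact Submodule.zero_mem _
    · rw [Submodule.span_le]
      rintro _ ⟨⟨u, hu⟩, rfl⟩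
      refine Submodule.subset_span ⟨_, ⟨(u, false), by simpa using hu, rfl⟩, ?_⟩
      ext y
      simp [π, LinearMap.funLeft, halfVec, Matrix.col, SimpleGraph.adjMatrix_apply]
  rw [h4, ← Matrix.rank_eq_finrank_span_cols] at h2
  have h5 : pairRank G Pᶜ (halfSet false A) =
      ((G.adjMatrix (ZMod 2)).submatrix (fun x : (Pᶜ : Finset V) => (x : V))
        (fun y : halfSet false A => (y : V))).rank := by
    unfold pairRank
    congr!
  have h6 := card_add_card_compl P
  rw [Fintype.card_coe] at h1
  rw [h5, halfRk, ← hW]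
  omega

/-- The half-rank of a graph. -/
noncomputable def graphHalfRank (G : SimpleGraph V) : HalfRank V where
  r A := halfRk G A
  submod A B := by exact_mod_cast halfRk_submod G A B
  le_insert e A := by exact_mod_cast halfRk_mono G (subset_insert e A)
  insert_le e A := by exact_mod_cast halfRk_insert_le G e A
  symm A := by
    have h1 : halfSet true (perp A) = (halfSet false A)ᶜ := by ext; simp
    have h2 : halfSet false (perp A) = (halfSet true A)ᶜ := by ext; simp
    rw [halfRk_eq, halfRk_eq G A, h1, h2, compl_compl, pairRank_comm G (halfSet false A),
      ← card_halfSet_add A, ← card_halfSet_add (perp A), h1, h2]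
    have h3 := card_add_card_compl (halfSet true A)
    have h4 := card_add_card_compl (halfSet false A)
    omega

theorem lam_graphHalfRank (G : SimpleGraph V) (X : Finset V) :
    (graphHalfRank G).lam X = cutRank G X := by
  have h : ∀ s, halfSet s (dbl X) = X := fun s => by ext; simp
  simp [HalfRank.lam, graphHalfRank, halfRk_eq, h, cutRank, pairRank_comm G X]

theorem lam₁_graphHalfRank (G : SimpleGraph V) {v : V} {X : Finset V} (hv : v ∉ X) :
    (graphHalfRank G).lam₁ v true X = pairRank G X (insert v X)ᶜ := by
  have h1 : halfSet true (insert (v, true) (dbl X)) = insert v X := by ext; simp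
  have h2 : halfSet false (insert (v, true) (dbl X)) = X := by ext; simp
  simp only [HalfRank.lam₁, graphHalfRank, halfRk_eq, h1, h2, pairRank_comm G X,
    card_insert_of_notMem hv]
  push_cast
  ring

end Vec

section Pivot

variable [DecidableEq V] {G : SimpleGraph V} {v w : V}

theorem pivot_adj_of_ne {x y : V} (hxv : x ≠ v) (hxw : x ≠ w) (hyv : y ≠ v) (hyw : y ≠ w) :
    (pivot G v w).Adj x y ↔
      Xor (G.Adj x y) (Xor (G.Adj w y ∧ G.Adj x v) (G.Adj v y ∧ G.Adj x w)) := by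
  simp only [pivot, SimpleGraph.comap_adj, Equiv.swap_apply_of_ne_of_ne hxv hxw,
    Equiv.swap_apply_of_ne_of_ne hyv hyw, pivotComplement, PivotPair, Set.mem_sdiff,
    Set.mem_inter_iff, SimpleGraph.mem_neighborSet, Set.mem_singleton_iff, G.adj_comm x v,
    G.adj_comm x w, hxv, hxw, hyv, hyw, not_false_iff, and_true]
  by_cases a1 : G.Adj v x <;> by_cases a2 : G.Adj w x <;> by_cases a3 : G.Adj v y <;>
    by_cases a4 : G.Adj w y <;> simp [a1, a2, a3, a4, Xor]

theorem pivot_adj_left {x : V} (hvw : G.Adj v w) (hxv : x ≠ v) (hxw : x ≠ w) :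
    (pivot G v w).Adj x v ↔ G.Adj x w := by
  simp [pivot, Equiv.swap_apply_of_ne_of_ne hxv hxw, pivotComplement, PivotPair, Xor, hvw]

theorem pivot_adj_right {x : V} (hvw : G.Adj v w) (hxv : x ≠ v) (hxw : x ≠ w) :
    (pivot G v w).Adj x w ↔ G.Adj x v := by
  simp [pivot, Equiv.swap_apply_of_ne_of_ne hxv hxw, pivotComplement, PivotPair, Xor, hvw.symm]

theorem pivot_adj (hvw : G.Adj v w) : (pivot G v w).Adj v w := by
  simp [pivot, pivotComplement, PivotPair, Xor, hvw, hvw.symm]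

open scoped Classical in
/-- The row operations that turn the columns of `v` and `w` in the adjacency matrix of `G`, for an
edge `vw`, into the basis vectors of `v` and `w`. -/
noncomputable def pivotMap (G : SimpleGraph V) (v w : V) : (V → ZMod 2) →ₗ[ZMod 2] V → ZMod 2 where
  toFun f y := if y = v then f w else if y = w then f v else
    f y + f w * (if G.Adj y v then 1 else 0) + f v * (if G.Adj y w then 1 else 0)
  map_add' f g := by ext y; simp only [Pi.add_apply]; split_ifs <;> ring
  map_smul' a f := by
    ext y; simp only [Pi.smul_apply, smul_eq_mul, RingHom.id_apply]; split_ifs <;> ring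

theorem pivotMap_injective : Function.Injective (pivotMap G v w) := by
  rw [← LinearMap.ker_eq_bot, LinearMap.ker_eq_bot']
  intro f hf
  have hy : ∀ y, pivotMap G v w f y = 0 := fun y => by rw [hf]; rfl
  simp only [pivotMap, LinearMap.coe_mk, AddHom.coe_mk] at hy
  have hw : f w = 0 := by simpa using hy v
  have hv : f v = 0 := by
    have := hy w
    split_ifs at this with h <;> simp_all
  ext y
  have := hy y
  split_ifs at this <;> simp_all

/-- Exchanging the two halves of `v` and those of `w`. -/
def flipHalf (v w : V) (e : V × Bool) : V × Bool := (e.1, if e.1 = v ∨ e.1 = w then !e.2 else e.2)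

theorem pivotMap_halfVec (hvw : G.Adj v w) (e : V × Bool) :
    pivotMap G v w (halfVec G e) = halfVec (pivot G v w) (flipHalf v w e) := by
  classical
  have hne : v ≠ w := hvw.ne
  obtain ⟨x, s⟩ := e
  ext y
  simp only [pivotMap, LinearMap.coe_mk, AddHom.coe_mk]
  by_cases hxv : x = v
  · subst hxv
    by_cases hyv : y = x
    · subst hyv
      cases s <;> simp [flipHalf, halfVec, hne, hne.symm, hvw.symm]
    · by_cases hyw : y = w
      · subst hyw
        cases s <;> simp [flipHalf, halfVec, hyv, (pivot_adj hvw).symm]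
      · cases s
        · simp [flipHalf, halfVec, hyv, hyw, hvw.symm, CharTwo.add_self_eq_zero]
        · simp [flipHalf, halfVec, hyv, hyw, hne.symm, pivot_adj_left hvw hyv hyw]
  · by_cases hxw : x = w
    · subst hxw
      by_cases hyv : y = v
      · subst hyv
        cases s <;> simp [flipHalf, halfVec, hne, pivot_adj hvw]
      · by_cases hyw : y = x
        · subst hyw
          cases s <;> simp [flipHalf, halfVec, hyv, hvw, hne]
        · cases s
          · simp [flipHalf, halfVec, hyv, hyw, hvw, CharTwo.add_self_eq_zero]
          · simp [flipHalf, halfVec, hyv, hyw, hne, pivot_adj_right hvw hyv hyw]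
    · by_cases hyv : y = v
      · subst hyv
        cases s
        · simp [flipHalf, halfVec, hxv, hxw, (pivot G y w).adj_comm y x, G.adj_comm w x,
            pivot_adj_left hvw hxv hxw]
        · simp [flipHalf, halfVec, hxv, hxw, Ne.symm hxv, Ne.symm hxw]
      · by_cases hyw : y = w
        · subst hyw
          cases s
          · simp [flipHalf, halfVec, hxv, hxw, hyv, (pivot G v y).adj_comm y x, G.adj_comm v x,
              pivot_adj_right hvw hxv hxw]
          · simp [flipHalf, halfVec, hxv, hxw, hyv, Ne.symm hxv, Ne.symm hxw]
        · cases s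
          · simp only [flipHalf, halfVec, hxv, hxw, hyv, hyw, pivot_adj_of_ne hyv hyw hxv hxw,
              if_false, or_self]
            by_cases a1 : G.Adj y x <;> by_cases a2 : G.Adj w x <;> by_cases a3 : G.Adj y v <;>
              by_cases a4 : G.Adj v x <;> by_cases a5 : G.Adj y w <;>
              simp [a1, a2, a3, a4, a5, Xor, CharTwo.add_self_eq_zero]
          · simp [flipHalf, halfVec, hxv, hxw, hyv, hyw, Ne.symm hxv, Ne.symm hxw]

theorem halfRk_pivot (hvw : G.Adj v w) (A : Finset (V × Bool)) :
    halfRk (pivot G v w) (A.image (flipHalf v w)) = halfRk G A := by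
  have h : halfVec (pivot G v w) '' (A.image (flipHalf v w) : Finset (V × Bool)) =
      pivotMap G v w '' (halfVec G '' (A : Set (V × Bool))) := by
    rw [coe_image, Set.image_image, Set.image_image]
    exact Set.image_congr fun e _ => (pivotMap_halfVec hvw e).symm
  rw [halfRk, h, ← Submodule.map_span]
  exact (Submodule.equivMapOfInjective _ pivotMap_injective _).finrank_eq.symm

theorem lam₁_pivot [Fintype V] (hvw : G.Adj v w) {X : Finset V} (hv : v ∉ X) :
    (graphHalfRank G).lam₁ v false X = (graphHalfRank (pivot G v w)).lam₁ v true X := by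
  have h : (insert (v, false) (dbl X)).image (flipHalf v w) = insert (v, true) (dbl X) := by
    have hinv : ∀ e, flipHalf v w (flipHalf v w e) = e := by
      rintro ⟨x, s⟩; simp only [flipHalf]; split_ifs <;> simp
    ext ⟨x, s⟩
    have : (x, s) ∈ (insert (v, false) (dbl X)).image (flipHalf v w) ↔
        flipHalf v w (x, s) ∈ insert (v, false) (dbl X) := by
      rw [mem_image]
      constructor
      · rintro ⟨e, he, h⟩; rwa [← h, hinv]
      · exact fun h => ⟨_, h, hinv _⟩
    rw [this]
    by_cases hx : x = v
    · subst hx; cases s <;> simp [flipHalf, hv]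
    · simp [flipHalf, hx]
  simp only [HalfRank.lam₁, graphHalfRank]
  rw [← halfRk_pivot hvw, h]

end Pivot

section Main

variable [Fintype V] [DecidableEq V]

theorem isPrime_of_not_isSplit (G : SimpleGraph V) (hcard : 4 ≤ Fintype.card V)
    (h : ∀ A, ¬ IsSplit G A) : IsPrime G := by
  have hne : Nonempty V := Fintype.card_pos_iff.1 (by omega)
  -- a set without outgoing edges, enlarged if it is a single vertex, gives a split
  have key : ∀ X : Finset V, cutRank G X = 0 → X.Nonempty → #X + 2 ≤ Fintype.card V → False := by
    intro X h0 hX h2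
    have hpos := card_pos.2 hX
    by_cases hX2 : 2 ≤ #X
    · exact h X ⟨by omega, by rw [card_compl]; omega⟩
    · obtain ⟨y, hy⟩ : ∃ y, y ∉ X := by
        by_contra! hall
        rw [eq_univ_iff_forall.2 hall, card_univ] at h2
        omega
      have h3 := (graphHalfRank G).lam_insert_le hy
      rw [lam_graphHalfRank, lam_graphHalfRank] at h3
      refine h (insert y X) ⟨by omega, ?_⟩
      rw [card_compl, card_insert_of_notMem hy]
      omega
  refine ⟨⟨fun x y => ?_⟩, h⟩
  classical
  by_contra hxy
  set X : Finset V := univ.filter fun z => G.Reachable x z with hXdef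
  have h0 : cutRank G X = 0 := by
    have : (letI : DecidableRel G.Adj := Classical.decRel G.Adj
        ((G.adjMatrix (ZMod 2)).submatrix (fun x : X => (x : V))
          (fun y : (Xᶜ : Finset V) => (y : V)))) = 0 := by
      ext ⟨a, ha⟩ ⟨b, hb⟩
      have hab : ¬ G.Adj a b := by
        intro hab
        rw [mem_compl] at hb
        apply hb
        simp only [hXdef, mem_filter, mem_univ, true_and] at ha ⊢
        exact ha.trans hab.reachable
      simp [SimpleGraph.adjMatrix_apply, hab]
    simp only [cutRank, pairRank] at this ⊢
    rw [this, Matrix.rank_zero]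
  have h0' : cutRank G Xᶜ = 0 := by
    rw [cutRank, compl_compl, pairRank_comm]; exact h0
  have hx : x ∈ X := by simp [hXdef]
  have hy : y ∈ Xᶜ := by simpa [hXdef] using hxy
  have hsum := card_add_card_compl X
  by_cases h2 : #X + 2 ≤ Fintype.card V
  · exact key X h0 ⟨x, hx⟩ h2
  · exact key Xᶜ h0' ⟨y, hy⟩ (by omega)

/-- The cut-rank of the graph with the vertex `v` deleted. -/
theorem cutRank_delete (G : SimpleGraph V) (v : V) (X : Finset ({v}ᶜ : Finset V)) :
    (cutRank (G.comap fun s : ({v}ᶜ : Finset V) => (s : V)) X : ℤ) =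
      (graphHalfRank G).lam₁ v true (X.map (.subtype _)) := by
  rw [lam₁_graphHalfRank G (by simp), cutRank, pairRank_comap]
  congr 3
  ext x
  by_cases hx : x = v <;> simp [hx]

/-- A prime and sufficiently rank-connected graph has a vertex that can be removed, either by
deleting it or by deleting it after pivoting one of its edges. -/
theorem exists_removable (G : SimpleGraph V) (hprime : IsPrime G)
    (hconn : RankConnectedPlus 3 2 G) (hcard : 10 ≤ Fintype.card V) :
    ∃ v s, (∀ X, ¬ (graphHalfRank G).IsSplitAt v s X) ∧
      ∀ S S', ¬ (graphHalfRank G).IsSep v s S S' := by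
  by_contra! hbad
  refine HalfRank.not_isCritical (c := graphHalfRank G) ⟨?_, ?_, hcard, ?_⟩
  · intro X h1 h2
    by_contra hlt
    rw [lam_graphHalfRank] at hlt
    refine hprime.2 X ⟨by omega, ?_⟩
    rw [card_compl]; omega
  · intro X h1 h2
    by_contra hlt
    rw [lam_graphHalfRank] at hlt
    have := hconn X (by omega)
    rw [card_compl] at this
    omega
  · intro v s
    by_cases hs : ∃ X, (graphHalfRank G).IsSplitAt v s X
    · exact Or.inl hs
    · exact Or.inr (hbad v s fun X hX => hs ⟨X, hX⟩)

theorem delete_isPrime_and_rankConnectedPlus (G : SimpleGraph V) (hcard : 10 ≤ Fintype.card V)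
    (v : V) (hsplit : ∀ X, ¬ (graphHalfRank G).IsSplitAt v true X)
    (hsep : ∀ S S', ¬ (graphHalfRank G).IsSep v true S S') :
    IsPrime (G.comap fun s : ({v}ᶜ : Finset V) => (s : V)) ∧
      RankConnectedPlus 3 3 (G.comap fun s : ({v}ᶜ : Finset V) => (s : V)) := by
  have hc : Fintype.card ({v}ᶜ : Finset V) + 1 = Fintype.card V := by
    rw [Fintype.card_coe, card_compl, card_singleton]; omega
  constructor
  · refine isPrime_of_not_isSplit _ (by omega) fun X ⟨h1, h2⟩ => ?_
    rw [card_compl] at h2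
    refine hsplit (X.map (.subtype _)) ⟨by simp, by rw [card_map]; omega, by rw [card_map]; omega, ?_⟩
    rw [← cutRank_delete]; omega
  · intro X hX
    by_contra hlt
    rw [card_compl] at hlt
    have hv : v ∉ X.map (.subtype (· ∈ ({v}ᶜ : Finset V))) := by simp
    have h1 := HalfRank.card_compl_insert hv
    rw [card_map] at h1
    refine hsep (X.map (.subtype _)) _ ⟨rfl, hv, by rw [card_map]; omega, by omega, ?_⟩
    rw [← cutRank_delete]; omega

end Main

end RankConnectivity

theorem theorem4p1 {V : Type*} [Fintype V] [DecidableEq V] (G : SimpleGraph V)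
    (hprime : RankConnectivity.IsPrime G)
    (hconn : RankConnectivity.RankConnectedPlus 3 2 G)
    (hcard : 10 ≤ Fintype.card V) :
    ∃ (S : Finset V) (H : SimpleGraph S),
      RankConnectivity.IsPivotMinor H G ∧
      RankConnectivity.IsPrime H ∧
      RankConnectivity.RankConnectedPlus 3 3 H ∧
      Fintype.card S = Fintype.card V - 1 := by
  open RankConnectivity in
  obtain ⟨v, s, hsplit, hsep⟩ := exists_removable G hprime hconn hcard
  have hc : Fintype.card ({v}ᶜ : Finset V) = Fintype.card V - 1 := by
    rw [Fintype.card_coe, Finset.card_compl, Finset.card_singleton]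
  cases s
  · have : Nontrivial V := Fintype.one_lt_card_iff_nontrivial.1 (by omega)
    obtain ⟨w, hvw⟩ := hprime.1.preconnected.exists_adj_of_nontrivial v
    obtain ⟨h1, h2⟩ := delete_isPrime_and_rankConnectedPlus (pivot G v w) hcard v
      (fun X hX => hsplit X ⟨hX.notMem, hX.two_le, hX.card_le, by
        rw [lam₁_pivot hvw hX.notMem]; exact hX.le⟩)
      (fun S S' hS => hsep S S' ⟨hS.eq_compl, hS.notMem, hS.six_le, hS.six_le', by
        rw [lam₁_pivot hvw hS.notMem]; exact hS.le⟩)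
    exact ⟨_, _, ⟨_, .single ⟨v, w, hvw, rfl⟩, rfl⟩, h1, h2, hc⟩
  · obtain ⟨h1, h2⟩ := delete_isPrime_and_rankConnectedPlus G hcard v hsplit hsep
    exact ⟨_, _, ⟨_, .refl, rfl⟩, h1, h2, hc⟩
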